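/- Let $n\ge 100$, $p\ge(16n)^4$ and $0\le s\le n$ be integers and let $\sigma>0$. Let $\mathbf H\in\mathbb R^{n\times p}$ have i.i.d. standard Gaussian entries, and let $\epsilon_1,\dots,\epsilon_n$ be i.i.d. Gaussian with mean $0$ and variance $\sigma^2$, independent of $\mathbf H$. Let $\mathbf X_{\mathrm{train}}\in\mathbb R^{n\times p}$ be the matrix with columns $\mathbf X_i=\mathbf H_i/\|\mathbf H_i\|_2$, where $\mathbf H_i$ is the $i$-th column of $\mathbf H$, and let $\epsilon_{\mathrm{train}}=(\epsilon_1,\dots,\epsilon_n)^T/\sqrt n$. Let $w^I\in\mathbb R^p$ be a solution of $$\min_w\|w\|_1\quad\text{subject to}\quad \mathbf X_{\mathrm{train}}w=\epsilon_{\mathrm{train}},\qquad w_1=\dots=w_s=0 .$$ Then, with probability at least $1-2e^{-n/4}$, we have $\epsilon_{\mathrm{train}}\neq 0$, a solution $w^I$ exists, and every solution $w^I$ satisfies $$\frac{\|w^I\|_1}{\|\epsilon_{\mathrm{train}}\|_2}\le\sqrt{1+\frac{3n/2}{\ln p}} .$$ -/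

import Mathlib

open MeasureTheory ProbabilityTheory
open scoped NNReal Matrix

noncomputable section

/-- The `ℓ¹`-norm of a real vector. -/
def l1Norm {ι : Type*} [Fintype ι] (v : ι → ℝ) : ℝ := ‖WithLp.toLp 1 v‖

/-- The `ℓ²`-norm of a real vector. -/
def l2Norm {ι : Type*} [Fintype ι] (v : ι → ℝ) : ℝ := ‖WithLp.toLp 2 v‖

/-- `n` i.i.d. samples of the Gaussian linear model: `H k i` is the `i`-th feature of the `k`-th
sample and `ε k` is the noise of the `k`-th sample. All features are standard Gaussian, all noises
are centred Gaussian with variance `σ ^ 2`, and all these variables are jointly independent. -/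
structure IsGaussianSample {Ω : Type*} [MeasurableSpace Ω] (μ : Measure Ω) {n p : ℕ} (σ : ℝ≥0)
    (H : Fin n → Fin p → Ω → ℝ) (ε : Fin n → Ω → ℝ) : Prop where
  law_feature : ∀ k i, HasLaw (H k i) (gaussianReal 0 1) μ
  law_noise : ∀ k, HasLaw (ε k) (gaussianReal 0 (σ ^ 2)) μ
  indep : iIndepFun
    (fun j : (Fin n × Fin p) ⊕ Fin n => Sum.elim (fun q => H q.1 q.2) ε j) μ

/-- The matrix obtained from `H` by dividing each column by its `ℓ²`-norm. -/
def normalizeColumns {n p : ℕ} (H : Matrix (Fin n) (Fin p) ℝ) : Matrix (Fin n) (Fin p) ℝ :=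
  Matrix.of fun k i => H k i / l2Norm (H.col i)

/-- The training matrix at the outcome `ω`. -/
def Xtrain {Ω : Type*} {n p : ℕ} (H : Fin n → Fin p → Ω → ℝ) (ω : Ω) :
    Matrix (Fin n) (Fin p) ℝ :=
  normalizeColumns (Matrix.of fun k i => H k i ω)

/-- The training noise vector at the outcome `ω`, with entries `ε_k / √n`. -/
def noiseTrain {Ω : Type*} {n : ℕ} (ε : Fin n → Ω → ℝ) (ω : Ω) : Fin n → ℝ :=
  fun k => ε k ω / √(n : ℝ)

/-- The feasible vectors: `X w = e`, and the first `s` entries of `w` vanish. -/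
def noiseFits {n p : ℕ} (s : ℕ) (X : Matrix (Fin n) (Fin p) ℝ) (e : Fin n → ℝ) :
    Set (Fin p → ℝ) :=
  {w | X *ᵥ w = e ∧ ∀ i : Fin p, (i : ℕ) < s → w i = 0}

/-- `w` solves: minimize `‖w‖₁` subject to `X w = e` and the first `s` entries of `w` vanish. -/
def IsMinNoiseFit {n p : ℕ} (s : ℕ) (X : Matrix (Fin n) (Fin p) ℝ) (e : Fin n → ℝ)
    (w : Fin p → ℝ) : Prop :=
  w ∈ noiseFits s X e ∧ IsMinOn l1Norm (noiseFits s X e) w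

end

/-!
By minimality, it suffices to exhibit, with the required probability, one vector `w` that fits the
noise `e`, vanishes on the first `s` coordinates and has `ℓ¹`-norm at most `M ‖e‖`, where
`M = √(1 + (3 n / 2) / log p)`. A minimizer then exists by compactness. The noise is independent
of the features, so `e` may be fixed and nonzero, and the columns `h i` are independent standard
Gaussian vectors.

If no such `w` exists, the Hahn–Banach theorem provides `l` with `M ‖e‖ |⟪l, X i⟫| < ⟪l, e⟫` for
all normalized columns `X i` with `s ≤ i` (`exists_separating_of_not_hasFit`). Call `h i` aligned
if the line it spans makes with `e` an angle of cosine at least `1 / M`. For an aligned column, the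
inequality forces the component `m` of `l` orthogonal to `e` to be negative on `h i`, after `h i`
has been oriented along `e` (`exists_orthogonal_of_not_hasFit`). Reflecting columns along `e`
preserves the Gaussian measure and the set of aligned columns and does not change `⟪m, h i⟫`, but
reverses the orientation. So, for given columns, every choice of reflections without a suitable
`w` is, on the aligned columns, a sign pattern cut out by a half-space. Homogeneous
half-spaces of `ℝⁿ` have Vapnik–Chervonenkis dimension at most `n`, and the Sauer–Shelah lemma
bounds the proportion of such choices by `3 ^ n (2 / 3) ^ N` for `N` aligned columns
(`card_le_of_sign_patterns`). For `N ≥ 4 n` this is at most `exp (-n / 4)`, and averaging over the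
reflections bounds the probability (`measureReal_aligned_and_not_hasFit_le`).

It remains to see that at least `4 n` columns are aligned, up to probability `exp (-n / 4)`. A
column is aligned as soon as its coordinate along `e` has square at least `log p` and the other
coordinates have square sum at most `3 n / 2`. The first event has probability of order
`p ^ (-1 / 2) / √(log p)` and the second at least `1 / 3` (`le_stdGaussian_isAligned`), so about
`√p / √(log p)` aligned columns are expected, and a Chernoff bound applies
(`measureReal_card_filter_le`).
-/

/-! ### Fits of bounded norm -/

/-- Some vector vanishing on the first `s` coordinates solves `X w = e` and has `ℓ¹`-norm at
most `R`. -/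
def HasFit {n p : ℕ} (s : ℕ) (X : Matrix (Fin n) (Fin p) ℝ) (e : Fin n → ℝ) (R : ℝ) : Prop :=
  ∃ w ∈ noiseFits s X e, l1Norm w ≤ R

lemma continuous_l1Norm {ι : Type*} [Fintype ι] : Continuous (l1Norm : (ι → ℝ) → ℝ) :=
  (PiLp.continuous_toLp 1 _).norm

lemma continuous_l2Norm {ι : Type*} [Fintype ι] : Continuous (l2Norm : (ι → ℝ) → ℝ) :=
  (PiLp.continuous_toLp 2 _).norm

lemma isClosed_noiseFits {n p : ℕ} (s : ℕ) (X : Matrix (Fin n) (Fin p) ℝ) (e : Fin n → ℝ) :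
    IsClosed (noiseFits s X e) := by
  simp only [noiseFits, Set.ofPred_and, Set.ofPred_forall]
  refine IsClosed.inter (isClosed_eq (by fun_prop) continuous_const) ?_
  exact isClosed_iInter fun i => isClosed_iInter fun _ => isClosed_eq (by fun_prop) continuous_const

lemma isCompact_l1Norm_le {ι : Type*} [Fintype ι] (R : ℝ) :
    IsCompact {w : ι → ℝ | l1Norm w ≤ R} := by
  have h := (isCompact_closedBall (0 : PiLp 1 (fun _ : ι => ℝ)) R).image
    (PiLp.continuous_ofLp 1 (fun _ : ι => ℝ))
  convert h using 1
  ext w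
  simp only [Set.mem_ofPred_eq, Set.mem_image, mem_closedBall_zero_iff, l1Norm]
  exact ⟨fun hw => ⟨WithLp.toLp 1 w, hw, rfl⟩, by rintro ⟨x, hx, rfl⟩; exact hx⟩

lemma exists_isMinNoiseFit {n p s : ℕ} {X : Matrix (Fin n) (Fin p) ℝ} {e : Fin n → ℝ}
    (h : (noiseFits s X e).Nonempty) : ∃ w, IsMinNoiseFit s X e w := by
  obtain ⟨w₀, hw₀⟩ := h
  obtain ⟨w, hw, hmin⟩ := ((isCompact_l1Norm_le (l1Norm w₀)).inter_left
    (isClosed_noiseFits s X e)).exists_isMinOn ⟨w₀, hw₀, le_refl (l1Norm w₀)⟩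
    continuous_l1Norm.continuousOn
  refine ⟨w, hw.1, fun v hv => ?_⟩
  rcases le_total (l1Norm v) (l1Norm w₀) with h | h
  · exact hmin ⟨hv, h⟩
  · exact hw.2.trans h

/-- The set of data admitting a fit of norm at most `M ‖e‖₂` is the projection of a closed set
along a `σ`-compact space, hence itself `σ`-compact. -/
lemma measurableSet_hasFit {n p : ℕ} (s : ℕ) (M : ℝ) :
    MeasurableSet {x : (Fin n → Fin p → ℝ) × (Fin n → ℝ) |
      HasFit s (Matrix.of x.1) x.2 (M * l2Norm x.2)} := by
  set C : Set (((Fin n → Fin p → ℝ) × (Fin n → ℝ)) × (Fin p → ℝ)) :=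
    {y | (Matrix.of y.1.1 *ᵥ y.2 = y.1.2 ∧ ∀ i : Fin p, (i : ℕ) < s → y.2 i = 0) ∧
      l1Norm y.2 ≤ M * l2Norm y.1.2} with hCdef
  have hC : IsClosed C := by
    simp only [hCdef, Set.ofPred_and, Set.ofPred_forall]
    refine IsClosed.inter (IsClosed.inter ?_ ?_) ?_
    · refine isClosed_eq ?_ (by fun_prop)
      exact Continuous.matrix_mulVec 
        (A := fun y : ((Fin n → Fin p → ℝ) × (Fin n → ℝ)) × (Fin p → ℝ) => Matrix.of y.1.1)
        (continuous_fst.comp continuous_fst) continuous_snd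
    · exact isClosed_iInter fun i => isClosed_iInter fun _ =>
        isClosed_eq (by fun_prop) continuous_const
    · exact isClosed_le (continuous_l1Norm.comp continuous_snd)
        (continuous_const.mul (continuous_l2Norm.comp (by fun_prop)))
  have hσ : IsSigmaCompact C := isSigmaCompact_univ.of_isClosed_subset hC (Set.subset_univ _)
  obtain ⟨K, hK, hKU⟩ := hσ.image continuous_fst
  have : {x : (Fin n → Fin p → ℝ) × (Fin n → ℝ) |
      HasFit s (Matrix.of x.1) x.2 (M * l2Norm x.2)} = Prod.fst '' C := by
    ext x
    constructor
    · rintro ⟨w, hw, hR⟩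
      exact ⟨(x, w), ⟨hw, hR⟩, rfl⟩
    · rintro ⟨y, ⟨hw, hR⟩, rfl⟩
      exact ⟨y.2, hw, hR⟩
  rw [this, ← hKU]
  exact MeasurableSet.iUnion fun i => (hK i).measurableSet

lemma l1Norm_single {ι : Type*} [Fintype ι] [DecidableEq ι] (i : ι) (a : ℝ) :
    l1Norm (Pi.single i a) = |a| := by
  simp [l1Norm, PiLp.norm_single]

/-- Linear programming duality: if no fit has norm at most `R`, then the point `e` is strictly
separated from the symmetric hull of the available columns, scaled by `R`. -/
lemma exists_separating_of_not_hasFit {n p s : ℕ} {X : Matrix (Fin n) (Fin p) ℝ}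
    {e : Fin n → ℝ} {R : ℝ} (hR : 0 ≤ R) (h : ¬ HasFit s X e R) :
    ∃ l : Fin n → ℝ, 0 < l ⬝ᵥ e ∧ ∀ i : Fin p, s ≤ (i : ℕ) → R * |l ⬝ᵥ X.col i| < l ⬝ᵥ e := by
  set W : Set (Fin p → ℝ) := {w | ∀ i : Fin p, (i : ℕ) < s → w i = 0} ∩ {w | l1Norm w ≤ R}
  have hWcl : IsClosed {w : Fin p → ℝ | ∀ i : Fin p, (i : ℕ) < s → w i = 0} := by
    simp only [Set.ofPred_forall]
    exact isClosed_iInter fun i => isClosed_iInter fun _ =>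
        isClosed_eq (by fun_prop) continuous_const
  have hWc : IsCompact W := (isCompact_l1Norm_le R).inter_left hWcl
  have hWconv : Convex ℝ W := by
    refine Convex.inter ?_ ?_
    · intro x hx y hy a b _ _ _ i hi
      simp [hx i hi, hy i hi]
    · intro x hx y hy a b ha hb hab
      simp only [Set.mem_ofPred_eq, l1Norm] at hx hy ⊢
      have := convex_closedBall (0 : PiLp 1 (fun _ : Fin p => ℝ)) R
        (mem_closedBall_zero_iff.2 hx) (mem_closedBall_zero_iff.2 hy) ha hb hab
      simpa [mem_closedBall_zero_iff] using this
  have hK : IsClosed (X.mulVecLin '' W) :=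
    (hWc.image (LinearMap.continuous_of_finiteDimensional _)).isClosed
  have hKconv : Convex ℝ (X.mulVecLin '' W) := hWconv.linear_image _
  have he : e ∉ X.mulVecLin '' W := by
    rintro ⟨w, ⟨hw0, hw1⟩, hwe⟩
    exact h ⟨w, ⟨by simpa using hwe, hw0⟩, hw1⟩
  obtain ⟨f, u, hfu, hue⟩ := geometric_hahn_banach_closed_point hKconv hK he
  have hf : ∀ x : Fin n → ℝ, f x = (fun k => f (Pi.single k 1)) ⬝ᵥ x := by
    intro x
    conv_lhs => rw [pi_eq_sum_univ' x]
    simp [dotProduct, mul_comm, map_sum]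
  refine ⟨fun k => f (Pi.single k 1), ?_, fun i hi => ?_⟩
  · rw [← hf]
    have := hfu (X.mulVecLin 0) ⟨0, ⟨by simp, by simpa [l1Norm] using hR⟩, rfl⟩
    simp at this
    linarith
  · rw [← hf, ← hf]
    have key : ∀ a : ℝ, |a| ≤ R → a * f (X.col i) < f e := by
      intro a ha
      have hmem : Pi.single i a ∈ W := by
        refine ⟨fun j hj => ?_, ?_⟩
        · have : j ≠ i := by rintro rfl; omega
          simp [this]
        · simpa [l1Norm_single] using ha
      have := hfu _ ⟨_, hmem, rfl⟩
      rw [Matrix.mulVecLin_apply, Matrix.mulVec_single] at this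
      have h2 : f (MulOpposite.op a • X.col i) = a * f (X.col i) := by
        rw [← smul_eq_mul, ← map_smul]; congr 1; ext k; simp [mul_comm]
      rw [h2] at this
      linarith
    rcases abs_cases (f (X.col i)) with ⟨h1, _⟩ | ⟨h1, _⟩
    · rw [h1]; exact key R (by rw [abs_of_nonneg hR])
    · rw [h1, mul_neg, ← neg_mul]; exact key (-R) (by rw [abs_neg, abs_of_nonneg hR])

/-! ### Counting sign patterns -/

/-- Open homogeneous half-spaces shatter at most `finrank` many points: for a larger set, the
signs of the coefficients of a linear dependence form an unrealisable pattern. -/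
lemma card_le_finrank_of_sign_patterns {α V : Type*} [AddCommGroup V] [Module ℝ V]
    [FiniteDimensional ℝ V] (v : α → V) (t : Finset α)
    (ht : ∀ u ⊆ t, ∃ f : V →ₗ[ℝ] ℝ, ∀ i ∈ t, (i ∈ u → 0 < f (v i)) ∧ (i ∉ u → f (v i) < 0)) :
    t.card ≤ Module.finrank ℝ V := by
  classical
  by_contra hlt
  have hdep : ¬ LinearIndependent ℝ (fun i : t => v i) := fun hli =>
    hlt (by simpa using hli.fintype_card_le_finrank)
  obtain ⟨a, ha, j, hj⟩ := Fintype.not_linearIndependent_iff.1 hdep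
  obtain ⟨f, hf⟩ := ht ((Finset.univ.filter fun i : t => 0 < a i).map
    (Function.Embedding.subtype _)) (by intro i hi; simp at hi; exact hi.1)
  have hpos : ∀ i : t, a i ≠ 0 → 0 < a i * f (v i) := by
    intro i hi
    obtain ⟨h1, h2⟩ := hf i i.2
    rcases lt_or_gt_of_ne hi with h | h
    · exact mul_pos_of_neg_of_neg h (h2 (by simp [h.le]))
    · exact mul_pos h (h1 (by simp [h]))
  have hsum : ∑ i, a i * f (v i) = 0 := by
    simpa [map_sum] using congrArg f ha
  have : 0 < ∑ i, a i * f (v i) := by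
    refine Finset.sum_pos' (fun i _ => ?_) ⟨j, Finset.mem_univ _, hpos j hj⟩
    by_cases hi : a i = 0
    · simp [hi]
    · exact (hpos i hi).le
  linarith

/-- A Chernoff bound for the number of subsets meeting `G` in at most `d` elements. -/
lemma card_filter_inter_le {α : Type*} [Fintype α] [DecidableEq α] (G : Finset α) (d : ℕ)
    {a : ℝ} (ha : 1 ≤ a) :
    (((Finset.univ : Finset (Finset α)).filter fun t => (t ∩ G).card ≤ d).card : ℝ) ≤
      2 ^ Fintype.card α * (a ^ d * ((1 + a⁻¹) / 2) ^ G.card) := by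
  have ha0 : 0 < a := by linarith
  have hprod : ∑ t : Finset α, (a⁻¹) ^ (t ∩ G).card
      = 2 ^ Fintype.card α * ((1 + a⁻¹) / 2) ^ G.card := by
    have h1 : ∀ t : Finset α, (a⁻¹) ^ (t ∩ G).card = ∏ i ∈ t, if i ∈ G then a⁻¹ else 1 := by
      intro t
      rw [Finset.prod_ite, Finset.prod_const_one, mul_one, Finset.prod_const,
        Finset.filter_mem_eq_inter]
    have h2 : ∀ i : α, (1 + if i ∈ G then a⁻¹ else 1)
        = 2 * if i ∈ G then (1 + a⁻¹) / 2 else 1 := by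
      intro i; split_ifs <;> ring
    simp_rw [h1]
    rw [← Finset.powerset_univ, ← Finset.prod_one_add]
    simp_rw [h2]
    rw [Finset.prod_mul_distrib, Finset.prod_const, Finset.prod_ite_mem, Finset.prod_const]
    simp
  calc _ = ∑ t ∈ (Finset.univ : Finset (Finset α)).filter fun t => (t ∩ G).card ≤ d, (1 : ℝ) := by
        simp
    _ ≤ ∑ t ∈ (Finset.univ : Finset (Finset α)).filter fun t => (t ∩ G).card ≤ d,
          a ^ d * (a⁻¹) ^ (t ∩ G).card := by
        refine Finset.sum_le_sum fun t ht => ?_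
        rw [inv_pow, ← div_eq_mul_inv, one_le_div (by positivity)]
        exact pow_le_pow_right₀ ha (Finset.mem_filter.1 ht).2
    _ ≤ ∑ t : Finset α, a ^ d * (a⁻¹) ^ (t ∩ G).card :=
        Finset.sum_le_sum_of_subset_of_nonneg (Finset.subset_univ _)
          fun _ _ _ => by positivity
    _ = _ := by rw [← Finset.mul_sum, hprod]; ring

/-- By the Sauer–Shelah lemma, the subsets of `α` whose trace on `G` is cut out from the points
`v i` by an open half-space, with none of these points on its boundary, are few. -/
lemma card_le_of_sign_patterns {α V : Type*} [Fintype α] [DecidableEq α] [AddCommGroup V]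
    [Module ℝ V] [FiniteDimensional ℝ V] (v : α → V) (G : Finset α) (𝒜 : Finset (Finset α))
    (h𝒜 : ∀ u ∈ 𝒜, ∃ f : V →ₗ[ℝ] ℝ, ∀ i ∈ G, (i ∈ u → 0 < f (v i)) ∧ (i ∉ u → f (v i) < 0))
    {a : ℝ} (ha : 1 ≤ a) :
    (𝒜.card : ℝ) ≤
      2 ^ Fintype.card α * (a ^ Module.finrank ℝ V * ((1 + a⁻¹) / 2) ^ G.card) := by
  refine le_trans ?_ (card_filter_inter_le G (Module.finrank ℝ V) ha)
  refine Nat.cast_le.2 ((Finset.card_le_card_shatterer 𝒜).trans (Finset.card_le_card ?_))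
  intro t ht
  rw [Finset.mem_filter]
  refine ⟨Finset.mem_univ _, card_le_finrank_of_sign_patterns v _ fun u hu => ?_⟩
  have hsh : 𝒜.Shatters (t ∩ G) :=
    (Finset.mem_shatterer.1 ht).mono_right Finset.inter_subset_left
  obtain ⟨w, hw, hwu⟩ := hsh hu
  obtain ⟨f, hf⟩ := h𝒜 w hw
  refine ⟨f, fun i hi => ?_⟩
  have hiu : i ∈ u ↔ i ∈ w := by rw [← hwu]; simp [Finset.mem_inter.1 hi]
  rw [hiu]
  exact hf i (Finset.mem_inter.1 hi).2

/-! ### Aligned columns and reflections -/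

/-- The normalized design matrix whose `i`-th column points in the direction of `h i`. -/
noncomputable def designOfColumns {n p : ℕ} (h : Fin p → EuclideanSpace ℝ (Fin n)) :
    Matrix (Fin n) (Fin p) ℝ :=
  normalizeColumns (Matrix.of fun k i => h i k)

/-- The nonzero vector `x` makes with the line through `e` an angle of cosine at least `1 / M`. -/
def IsAligned {E : Type*} [NormedAddCommGroup E] [InnerProductSpace ℝ E] (M : ℝ) (e x : E) :
    Prop :=
  x ≠ 0 ∧ ‖x‖ * ‖e‖ ≤ M * |inner ℝ x e|

lemma designOfColumns_apply {n p : ℕ} (h : Fin p → EuclideanSpace ℝ (Fin n)) (k : Fin n)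
    (i : Fin p) : designOfColumns h k i = h i k / ‖h i‖ := rfl

lemma dotProduct_designOfColumns_col {n p : ℕ} (h : Fin p → EuclideanSpace ℝ (Fin n))
    (l : Fin n → ℝ) (i : Fin p) :
    l ⬝ᵥ (designOfColumns h).col i = inner ℝ (WithLp.toLp 2 l) (h i) / ‖h i‖ := by
  simp only [dotProduct, Matrix.col_apply, designOfColumns_apply, PiLp.inner_apply,
    Finset.sum_div]
  refine Finset.sum_congr rfl fun k _ => ?_
  simp
  ring

/-- If `e` has no fit of norm at most `M ‖e‖`, the component orthogonal to `e` of a separating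
functional is negative on every aligned column, once this column is oriented along `e`. -/
lemma exists_orthogonal_of_not_hasFit {n p s : ℕ} {h : Fin p → EuclideanSpace ℝ (Fin n)}
    {e : EuclideanSpace ℝ (Fin n)} (he : e ≠ 0) {M : ℝ} (hM : 0 < M)
    (hfit : ¬ HasFit s (designOfColumns h) e.ofLp (M * ‖e‖)) :
    ∃ m : EuclideanSpace ℝ (Fin n), inner ℝ m e = 0 ∧
      ∀ i : Fin p, s ≤ (i : ℕ) → IsAligned M e (h i) →
        inner ℝ m (h i) * inner ℝ (h i) e < 0 := by
  have hepos : 0 < ‖e‖ := norm_pos_iff.2 he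
  obtain ⟨l, hle, hl⟩ := exists_separating_of_not_hasFit (by positivity) hfit
  set L : EuclideanSpace ℝ (Fin n) := WithLp.toLp 2 l
  have hLe : l ⬝ᵥ e.ofLp = inner ℝ L e := by
    simp [L, PiLp.inner_apply, dotProduct, mul_comm]
  rw [hLe] at hle
  refine ⟨‖e‖ ^ 2 • L - inner ℝ L e • e, ?_, fun i hi hal => ?_⟩
  · rw [inner_sub_left, real_inner_smul_left, real_inner_smul_left,
      real_inner_self_eq_norm_sq]
    ring
  · have hsep := hl i hi
    rw [dotProduct_designOfColumns_col, hLe] at hsep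
    obtain ⟨hne, hang⟩ := hal
    have hhpos : 0 < ‖h i‖ := norm_pos_iff.2 hne
    rw [abs_div, abs_norm, mul_div_assoc', div_lt_iff₀ hhpos] at hsep
    have hce : inner ℝ e (h i) = inner ℝ (h i) e := real_inner_comm _ _
    rw [inner_sub_left, real_inner_smul_left, real_inner_smul_left, hce]
    set c : ℝ := inner ℝ (h i) e
    set a : ℝ := inner ℝ L e
    set y : ℝ := inner ℝ L (h i)
    have hc : 0 < |c| := by
      have : 0 < M * |c| := lt_of_lt_of_le (by positivity) hang
      exact pos_of_mul_pos_right this hM.le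
    have h1 : M * (‖e‖ ^ 2 * |y|) < M * (a * |c|) := by
      calc M * (‖e‖ ^ 2 * |y|) = ‖e‖ * (M * ‖e‖ * |y|) := by ring
        _ < ‖e‖ * (a * ‖h i‖) := by gcongr
        _ = a * (‖h i‖ * ‖e‖) := by ring
        _ ≤ a * (M * |c|) := by gcongr
        _ = _ := by ring
    have h2 : ‖e‖ ^ 2 * |y| < a * |c| := lt_of_mul_lt_mul_left h1 hM.le
    have h3 : y * c ≤ |y| * |c| := by rw [← abs_mul]; exact le_abs_self _
    calc (‖e‖ ^ 2 * y - a * c) * c = ‖e‖ ^ 2 * (y * c) - a * |c| * |c| := by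
          rw [mul_assoc a, abs_mul_abs_self]; ring
      _ ≤ ‖e‖ ^ 2 * (|y| * |c|) - a * |c| * |c| := by gcongr
      _ = (‖e‖ ^ 2 * |y| - a * |c|) * |c| := by ring
      _ < 0 := mul_neg_of_neg_of_pos (by linarith) hc

section Reflection

variable {E : Type*} [NormedAddCommGroup E] [InnerProductSpace ℝ E]

/-- The reflection negating `e` and fixing its orthogonal complement. -/
noncomputable def negReflection (e : E) : E ≃ₗᵢ[ℝ] E := (ℝ ∙ e)ᗮ.reflection

lemma negReflection_self (e : E) : negReflection e e = -e :=
  Submodule.reflection_orthogonalComplement_singleton_eq_neg e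

lemma inner_negReflection_self (e x : E) :
    inner ℝ (negReflection e x) e = -inner ℝ x e := by
  have := (negReflection e).inner_map_map x e
  rw [negReflection_self, inner_neg_right] at this
  linarith

lemma inner_negReflection_of_orthogonal {e m : E} (hm : inner ℝ m e = 0) (x : E) :
    inner ℝ m (negReflection e x) = inner ℝ m x := by
  have h1 : negReflection e m = m :=
    Submodule.reflection_mem_subspace_eq_self
      (Submodule.mem_orthogonal_singleton_iff_inner_left.2 hm)
  conv_lhs => rw [← h1]
  exact (negReflection e).inner_map_map m x

/-- Reflect along `e` the vectors with index in `τ`. -/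
noncomputable def reflectOn {ι : Type*} [DecidableEq ι] (e : E) (τ : Finset ι) (h : ι → E)
    (i : ι) : E :=
  if i ∈ τ then negReflection e (h i) else h i

lemma isAligned_negReflection {M : ℝ} {e x : E} :
    IsAligned M e (negReflection e x) ↔ IsAligned M e x := by
  simp [IsAligned, inner_negReflection_self]

lemma isAligned_reflectOn {ι : Type*} [DecidableEq ι] {M : ℝ} {e : E} {τ : Finset ι}
    {h : ι → E} {i : ι} : IsAligned M e (reflectOn e τ h i) ↔ IsAligned M e (h i) := by
  unfold reflectOn
  split_ifs
  · exact isAligned_negReflection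
  · rfl

end Reflection

/-- The columns with index at least `s` that are aligned with `e`. -/
noncomputable def alignedColumns {E : Type*} [NormedAddCommGroup E] [InnerProductSpace ℝ E]
    {p : ℕ} (s : ℕ) (M : ℝ) (e : E) (h : Fin p → E) : Finset (Fin p) :=
  open Classical in Finset.univ.filter fun i => s ≤ (i : ℕ) ∧ IsAligned M e (h i)

lemma mem_alignedColumns {E : Type*} [NormedAddCommGroup E] [InnerProductSpace ℝ E]
    {p s : ℕ} {M : ℝ} {e : E} {h : Fin p → E} {i : Fin p} :
    i ∈ alignedColumns s M e h ↔ s ≤ (i : ℕ) ∧ IsAligned M e (h i) := by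
  simp [alignedColumns]

lemma alignedColumns_reflectOn {E : Type*} [NormedAddCommGroup E] [InnerProductSpace ℝ E]
    {p s : ℕ} {M : ℝ} {e : E} {h : Fin p → E} (τ : Finset (Fin p)) :
    alignedColumns s M e (reflectOn e τ h) = alignedColumns s M e h := by
  ext i
  rw [mem_alignedColumns, mem_alignedColumns, isAligned_reflectOn]

open Classical in
/-- Among all reflections of a given family of columns, those without a fit of small norm are
few: each of them prescribes the signs of a linear functional on the aligned columns. -/
lemma card_not_hasFit_reflectOn_le {n p s : ℕ} {e : EuclideanSpace ℝ (Fin n)} (he : e ≠ 0)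
    {M : ℝ} (hM : 0 < M) (h : Fin p → EuclideanSpace ℝ (Fin n)) :
    (((Finset.univ : Finset (Finset (Fin p))).filter fun τ =>
        ¬ HasFit s (designOfColumns (reflectOn e τ h)) e.ofLp (M * ‖e‖)).card : ℝ) ≤
      2 ^ p * (3 ^ n * (2 / 3) ^ (alignedColumns s M e h).card) := by
  have key := card_le_of_sign_patterns (fun i => inner ℝ (h i) e • h i)
    (alignedColumns s M e h) ((Finset.univ : Finset (Finset (Fin p))).filter fun τ =>
        ¬ HasFit s (designOfColumns (reflectOn e τ h)) e.ofLp (M * ‖e‖)) ?_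
    (show (1 : ℝ) ≤ 3 by norm_num)
  · rw [Fintype.card_fin, finrank_euclideanSpace_fin] at key
    norm_num at key ⊢
    exact key
  · intro τ hτ
    obtain ⟨m, hme, hm⟩ := exists_orthogonal_of_not_hasFit he hM (Finset.mem_filter.1 hτ).2
    refine ⟨innerₗ _ m, fun i hi => ?_⟩
    obtain ⟨his, hia⟩ := mem_alignedColumns.1 hi
    have := hm i his (isAligned_reflectOn.2 hia)
    rw [innerₗ_apply_apply, real_inner_smul_right]
    constructor
    · intro hiτ
      rw [reflectOn, if_pos hiτ, inner_negReflection_self,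
        inner_negReflection_of_orthogonal hme] at this
      linarith
    · intro hiτ
      rw [reflectOn, if_neg hiτ] at this
      linarith

/-! ### Averaging over measure-preserving maps -/

open Classical in
/-- If every orbit meets `S` in at most `K` of the maps `T i`, then averaging over `i` bounds the
measure of `S`. -/
lemma card_mul_measureReal_le_of_card_filter_le {Ω ι : Type*} [MeasurableSpace Ω] [Fintype ι]
    (P : Measure Ω) [IsProbabilityMeasure P] (T : ι → Ω → Ω)
    (hT : ∀ i, MeasurePreserving (T i) P P) {S : Set Ω} (hS : MeasurableSet S) {K : ℝ}
    (hK : ∀ x, ((Finset.univ.filter fun i => T i x ∈ S).card : ℝ) ≤ K) :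
    Fintype.card ι * P.real S ≤ K := by
  have hint : ∀ i, Integrable (fun x => (T i ⁻¹' S).indicator (fun _ => (1 : ℝ)) x) P := fun i =>
    (integrable_const 1).indicator ((hT i).measurable hS)
  have h1 : ∑ i, ∫ x, (T i ⁻¹' S).indicator (fun _ => (1 : ℝ)) x ∂P
      = Fintype.card ι * P.real S := by
    have : ∀ i, ∫ x, (T i ⁻¹' S).indicator (fun _ => (1 : ℝ)) x ∂P = P.real S := by
      intro i
      rw [integral_indicator_const _ ((hT i).measurable hS), smul_eq_mul, mul_one,
        measureReal_def, (hT i).measure_preimage hS.nullMeasurableSet, measureReal_def]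
    simp [this]
  rw [← h1, ← integral_finsetSum _ fun i _ => hint i]
  calc _ ≤ ∫ _, K ∂P := by
        refine integral_mono (integrable_finsetSum _ fun i _ => hint i) (integrable_const K) ?_
        intro x
        refine le_trans (le_of_eq ?_) (hK x)
        simp [Set.indicator_apply]
    _ = K := by simp

/-! ### Concentration of the number of aligned columns -/

open Classical in
/-- Lower-tail Chernoff bound for the number of independent points falling into `A`. -/
lemma measureReal_card_filter_le {ι E : Type*} [Fintype ι] [MeasurableSpace E] (ν : Measure E)
    [IsProbabilityMeasure ν] {A : Set E} (hA : MeasurableSet A) {q : ℝ} (hq : q ≤ ν.real A)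
    (T : Finset ι) (k : ℝ) :
    (Measure.pi fun _ : ι => ν).real {h | ((T.filter fun i => h i ∈ A).card : ℝ) ≤ k} ≤
      Real.exp (k - 3 / 5 * q * T.card) := by
  set Y : E → ℝ := A.indicator fun _ => 1 with hY
  have hYm : Measurable Y := measurable_const.indicator hA
  set P := Measure.pi fun _ : ι => ν
  set X : ι → (ι → E) → ℝ := fun i h => Y (h i)
  have hXm : ∀ i, Measurable (X i) := fun i => hYm.comp (measurable_pi_apply i)
  have hind : iIndepFun X P := iIndepFun_pi (X := fun _ => Y) fun _ => hYm.aemeasurable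
  have hmgf : ∀ i, mgf (X i) P (-1) ≤ Real.exp (-(3 / 5 * q)) := by
    intro i
    have h1 : mgf (X i) P (-1) = ∫ x, Real.exp (-1 * Y x) ∂ν :=
      integral_comp_eval (μ := fun _ : ι => ν) (i := i) (f := fun x => Real.exp (-1 * Y x))
        (by fun_prop)
    have h2 : ∀ x, Real.exp (-1 * Y x)
        = 1 - (1 - Real.exp (-1)) * A.indicator (fun _ => 1) x := by
      intro x
      by_cases hx : x ∈ A <;> simp [hY, hx]
    rw [h1]
    simp_rw [h2]
    rw [integral_sub (integrable_const _)
      (((integrable_const _).indicator hA).const_mul _), integral_const_mul,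
      integral_indicator_const _ hA]
    have he : Real.exp (-1) ≤ 2 / 5 := by
      have := Real.exp_neg_one_lt_d9
      linarith
    have h3 : 0 ≤ ν.real A := measureReal_nonneg
    have h4 := Real.add_one_le_exp (-(3 / 5 * q))
    simp
    nlinarith
  have hsum : ∀ h, (∑ i ∈ T, X i) h = ((T.filter fun i => h i ∈ A).card : ℝ) := by
    intro h
    simp [X, hY, Set.indicator_apply]
  have hint : Integrable (fun h => Real.exp (-1 * (∑ i ∈ T, X i) h)) P := by
    refine Integrable.of_bound (C := 1) ?_ (.of_forall fun h => ?_)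
    · have : Measurable fun h => ∑ i ∈ T, X i h := Finset.measurable_sum _ fun i _ => hXm i
      simp only [Finset.sum_apply]
      fun_prop
    · rw [Real.norm_eq_abs, Real.abs_exp, Real.exp_le_one_iff, hsum]
      have : (0 : ℝ) ≤ ((T.filter fun i => h i ∈ A).card : ℝ) := by positivity
      linarith
  have key := measure_le_le_exp_mul_mgf (μ := P) (X := ∑ i ∈ T, X i) k
    (show (-1 : ℝ) ≤ 0 by norm_num) hint
  simp_rw [hsum] at key
  refine key.trans ?_
  rw [hind.mgf_sum hXm]
  calc _ ≤ Real.exp (- -1 * k) * ∏ _i ∈ T, Real.exp (-(3 / 5 * q)) := by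
        gcongr with i hi
        · exact fun i _ => mgf_nonneg
        · exact hmgf i
    _ = _ := by
        rw [Finset.prod_const, ← Real.exp_nat_mul, ← Real.exp_add]
        congr 1
        ring

/-! ### The probability that a Gaussian vector is aligned -/

/-- A Gaussian lower tail bound, from the values of the density on `[x, x + 1 / x]`. -/
lemma exp_div_le_gaussianReal_Ici {x : ℝ} (hx : 5 ≤ x) :
    Real.exp (-x ^ 2 / 2) / (9 * x) ≤ (gaussianReal 0 1).real (Set.Ici x) := by
  have hx0 : 0 < x := by linarith
  set c : ℝ := gaussianPDFReal 0 1 (x + 1 / x) with hc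
  have hc0 : 0 ≤ c := gaussianPDFReal_nonneg _ _ _
  have h1 : ENNReal.ofReal (c * (1 / x)) ≤ gaussianReal 0 1 (Set.Ici x) := by
    rw [gaussianReal_apply 0 one_ne_zero]
    calc ENNReal.ofReal (c * (1 / x)) = ∫⁻ _ in Set.Icc x (x + 1 / x), ENNReal.ofReal c := by
          rw [setLIntegral_const, Real.volume_Icc, ENNReal.ofReal_mul hc0, add_sub_cancel_left]
      _ ≤ ∫⁻ y in Set.Icc x (x + 1 / x), gaussianPDF 0 1 y := by
          refine setLIntegral_mono (measurable_gaussianPDF 0 1) fun y hy => ?_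
          refine ENNReal.ofReal_le_ofReal ?_
          have hy0 : 0 ≤ y := hx0.le.trans hy.1
          simp only [hc, gaussianPDFReal, sub_zero]
          gcongr
          exact hy.2
      _ ≤ _ := lintegral_mono_set fun y hy => hy.1
  have h2 : c * (1 / x) ≤ (gaussianReal 0 1).real (Set.Ici x) :=
    (ENNReal.ofReal_le_iff_le_toReal (measure_ne_top _ _)).1 h1
  refine le_trans ?_ h2
  have hexp : Real.exp (-x ^ 2 / 2) / 3 ≤ Real.exp (-(x + 1 / x) ^ 2 / 2) := by
    have h3 : -(x + 1 / x) ^ 2 / 2 = -x ^ 2 / 2 + -(1 + (1 / x) ^ 2 / 2) := by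
      field_simp
      ring
    have h4 : (1 / x) ^ 2 ≤ 1 / 25 := by
      have : 1 / x ≤ 1 / 5 := one_div_le_one_div_of_le (by norm_num) hx
      calc (1 / x) ^ 2 ≤ (1 / 5) ^ 2 := by gcongr
        _ = _ := by norm_num
    have h5 : Real.exp (1 + (1 / x) ^ 2 / 2) ≤ 3 := by
      calc Real.exp (1 + (1 / x) ^ 2 / 2) ≤ Real.exp (1 + 1 / 50) :=
            Real.exp_le_exp.2 (by linarith)
        _ = Real.exp 1 * Real.exp (1 / 50) := Real.exp_add _ _
        _ ≤ 2.7182818286 * (1 + 1 / 50 + (1 / 50) ^ 2) := by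
            have h6 := Real.exp_one_lt_d9
            have h7 := Real.abs_exp_sub_one_sub_id_le (x := 1 / 50)
              (by rw [abs_of_pos] <;> norm_num)
            have h8 := (abs_le.1 h7).2
            gcongr
            linarith
        _ ≤ 3 := by norm_num
    rw [h3, Real.exp_add, Real.exp_neg, ← div_eq_mul_inv]
    gcongr
  have hpi : (1 : ℝ) / 3 ≤ (√(2 * Real.pi * 1))⁻¹ := by
    rw [one_div]
    refine inv_anti₀ (by positivity) (Real.sqrt_le_iff.2 ⟨by norm_num, ?_⟩)
    have := Real.pi_lt_d2
    linarith
  calc Real.exp (-x ^ 2 / 2) / (9 * x) = (1 / 3) * (Real.exp (-x ^ 2 / 2) / 3) * (1 / x) := by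
        field_simp; norm_num
    _ ≤ c * (1 / x) := by
        gcongr
        simp only [hc, gaussianPDFReal, sub_zero, NNReal.coe_one, mul_one] at hpi ⊢
        gcongr

/-- By Markov's inequality, a sum of squares of independent standard Gaussian variables is at most
`3 / 2` times its mean, hence at most any larger `c`, with probability at least `1 / 3`. -/
lemma one_third_le_measureReal_sum_sq_le {ι : Type*} [Fintype ι] (T : Finset ι) {c : ℝ}
    (hc : 0 < c) (hT : 3 / 2 * (T.card : ℝ) ≤ c) :
    1 / 3 ≤ (Measure.pi fun _ : ι => gaussianReal 0 1).real {x | ∑ i ∈ T, x i ^ 2 ≤ c} := by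
  set P := Measure.pi fun _ : ι => gaussianReal 0 1
  have hsq : Integrable (fun y : ℝ => y ^ 2) (gaussianReal 0 1) :=
    (memLp_id_gaussianReal 2).integrable_sq
  have hint : ∀ i, Integrable (fun x : ι → ℝ => x i ^ 2) P := fun i =>
    (measurePreserving_eval (fun _ : ι => gaussianReal 0 1) i).integrable_comp_of_integrable hsq
  have hE : ∀ i, ∫ x, x i ^ 2 ∂P = 1 := by
    intro i
    rw [integral_comp_eval (μ := fun _ : ι => gaussianReal 0 1) (i := i)
      (f := fun y : ℝ => y ^ 2) hsq.aestronglyMeasurable]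
    have h1 := variance_id_gaussianReal (μ := 0) (v := 1)
    rw [variance_of_integral_eq_zero aemeasurable_id (by simp)] at h1
    simpa using h1
  have hmarkov := mul_meas_ge_le_integral_of_nonneg (μ := P)
    (f := fun x => ∑ i ∈ T, x i ^ 2)
    (.of_forall fun x => Finset.sum_nonneg fun i _ => sq_nonneg (x i))
    (integrable_finsetSum _ fun i _ => hint i) c
  rw [integral_finsetSum _ fun i _ => hint i] at hmarkov
  simp only [hE, Finset.sum_const, nsmul_eq_mul, mul_one] at hmarkov
  have hm : MeasurableSet {x : ι → ℝ | ∑ i ∈ T, x i ^ 2 ≤ c} :=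
    measurableSet_le (by fun_prop) measurable_const
  have hcompl : P.real {x : ι → ℝ | ∑ i ∈ T, x i ^ 2 ≤ c}ᶜ
      ≤ P.real {x : ι → ℝ | c ≤ ∑ i ∈ T, x i ^ 2} :=
    measureReal_mono fun x hx => by
      simp only [Set.mem_compl_iff, Set.mem_ofPred_eq, not_le] at hx ⊢
      exact hx.le
  rw [probReal_compl_eq_one_sub hm] at hcompl
  have : c * (1 - P.real {x : ι → ℝ | ∑ i ∈ T, x i ^ 2 ≤ c}) ≤ c * (2 / 3) := by
    calc _ ≤ c * P.real {x : ι → ℝ | c ≤ ∑ i ∈ T, x i ^ 2} := by gcongr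
      _ ≤ c * (2 / 3) := by linarith
  have := le_of_mul_le_mul_left this hc
  linarith

lemma measurableSet_isAligned {n : ℕ} (M : ℝ) (e : EuclideanSpace ℝ (Fin n)) :
    MeasurableSet {x | IsAligned M e x} := by
  simp only [IsAligned, Set.ofPred_and]
  refine MeasurableSet.inter (measurableSet_singleton 0).compl ?_
  exact measurableSet_le (by fun_prop) (by fun_prop)

/-- In an orthonormal basis starting with the direction of `e`, alignment follows from a first
coordinate of square at least `l` and a square sum of the others at most `3 n / 2`. These two
events are independent. -/
lemma le_stdGaussian_isAligned {n : ℕ} {e : EuclideanSpace ℝ (Fin n)} (he : e ≠ 0) {l : ℝ}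
    (hl : 25 ≤ l) :
    Real.exp (-l / 2) / (27 * √l) ≤ (stdGaussian (EuclideanSpace ℝ (Fin n))).real
      {x | IsAligned (√(1 + (3 * (n : ℝ) / 2) / l)) e x} := by
  have hl0 : 0 < l := by linarith
  have hn : 0 < n := by
    rcases Nat.eq_zero_or_pos n with rfl | h
    · exact absurd (Subsingleton.elim e 0) he
    · exact h
  have hepos : 0 < ‖e‖ := norm_pos_iff.2 he
  set j : Fin n := ⟨0, hn⟩
  obtain ⟨b, hb⟩ := Orthonormal.exists_orthonormalBasis_extension_of_card_eq (𝕜 := ℝ)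
    (E := EuclideanSpace ℝ (Fin n)) (ι := Fin n) (by simp)
    (v := fun _ => ‖e‖⁻¹ • e) (s := {j}) (by
      refine ⟨fun i => ?_, fun i k hik => absurd (Subsingleton.elim i k) hik⟩
      simp [norm_smul, hepos.ne'])
  have hbj : b j = ‖e‖⁻¹ • e := hb j rfl
  set P := Measure.pi fun _ : Fin n => gaussianReal 0 1
  set U : Finset (Fin n) := Finset.univ.erase j
  have hmeas : Measurable fun x : Fin n → ℝ => ∑ i, x i • b i := by fun_prop
  rw [stdGaussian_eq_map_pi_orthonormalBasis b, measureReal_def,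
    Measure.map_apply hmeas (measurableSet_isAligned _ _), ← measureReal_def]
  have hsub : (fun x : Fin n → ℝ => ∑ i ∈ U, x i ^ 2) ⁻¹' Set.Iic (3 * n / 2) ∩
      (fun x : Fin n → ℝ => x j ^ 2) ⁻¹' Set.Ici l ⊆
      (fun x => ∑ i, x i • b i) ⁻¹' {x | IsAligned (√(1 + (3 * (n : ℝ) / 2) / l)) e x} := by
    rintro x ⟨hx1, hx2⟩
    simp only [Set.mem_preimage, Set.mem_Iic, Set.mem_Ici] at hx1 hx2
    have hee : e = ‖e‖ • b j := by rw [hbj, smul_smul, mul_inv_cancel₀ hepos.ne', one_smul]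
    have hin : inner ℝ (∑ i, x i • b i) e = ‖e‖ * x j := by
      conv_lhs => rw [hee]
      rw [real_inner_smul_right]
      have := b.orthonormal.inner_left_fintype x j
      simp at this
      rw [this]
    have hnorm : ‖∑ i, x i • b i‖ ^ 2 = x j ^ 2 + ∑ i ∈ U, x i ^ 2 := by
      rw [← real_inner_self_eq_norm_sq, b.orthonormal.inner_sum,
        ← Finset.add_sum_erase _ _ (Finset.mem_univ j)]
      simp [U, sq]
    have hle : ‖∑ i, x i • b i‖ ^ 2 ≤ (1 + (3 * (n : ℝ) / 2) / l) * x j ^ 2 := by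
      have : 3 * (n : ℝ) / 2 ≤ (3 * (n : ℝ) / 2) / l * x j ^ 2 := by
        calc 3 * (n : ℝ) / 2 = (3 * (n : ℝ) / 2) / l * l := by field_simp
          _ ≤ _ := by gcongr
      linarith
    refine ⟨fun h0 => ?_, ?_⟩
    · rw [show ∑ i, x i • b i = 0 from h0] at hnorm
      have : 0 ≤ ∑ i ∈ U, x i ^ 2 := Finset.sum_nonneg fun i _ => sq_nonneg _
      simp at hnorm
      linarith
    · rw [hin, abs_mul, abs_norm, ← mul_assoc, mul_comm _ ‖e‖, mul_comm _ ‖e‖, mul_assoc]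
      gcongr
      rw [← Real.sqrt_sq_eq_abs, ← Real.sqrt_mul (by positivity)]
      exact Real.le_sqrt_of_sq_le hle
  refine le_trans ?_ (measureReal_mono hsub)
  have hind : iIndepFun (fun (i : Fin n) (x : Fin n → ℝ) => x i ^ 2) P :=
    iIndepFun_pi (X := fun _ : Fin n => fun y : ℝ => y ^ 2) fun _ => by fun_prop
  have hIF := hind.indepFun_finsetSum_of_notMem (fun i => by fun_prop)
    (Finset.notMem_erase j Finset.univ)
  have hsumeq : (∑ i ∈ U, fun x : Fin n → ℝ => x i ^ 2) = fun x => ∑ i ∈ U, x i ^ 2 := by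
    ext x; simp
  rw [show Finset.univ.erase j = U from rfl, hsumeq] at hIF
  rw [measureReal_def, hIF.measure_inter_preimage_eq_mul _ _ measurableSet_Iic measurableSet_Ici,
    ENNReal.toReal_mul, ← measureReal_def, ← measureReal_def]
  have h1 : 1 / 3 ≤ P.real ((fun x : Fin n → ℝ => ∑ i ∈ U, x i ^ 2) ⁻¹' Set.Iic (3 * n / 2)) := by
    refine one_third_le_measureReal_sum_sq_le U (by positivity) ?_
    have : (U.card : ℝ) ≤ n := by
      have := Finset.card_le_univ U
      rw [Fintype.card_fin] at this
      exact_mod_cast this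
    linarith
  have h2 : Real.exp (-l / 2) / (9 * √l) ≤
      P.real ((fun x : Fin n → ℝ => x j ^ 2) ⁻¹' Set.Ici l) := by
    have h3 := exp_div_le_gaussianReal_Ici (x := √l)
      (Real.le_sqrt_of_sq_le (by norm_num; exact hl))
    rw [Real.sq_sqrt hl0.le] at h3
    refine h3.trans ?_
    rw [← (measurePreserving_eval (fun _ : Fin n => gaussianReal 0 1) j).measureReal_preimage
      measurableSet_Ici.nullMeasurableSet]
    refine measureReal_mono fun x hx => ?_
    simp only [Set.mem_preimage, Function.eval, Set.mem_Ici] at hx ⊢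
    rw [← Real.sq_sqrt hl0.le]
    gcongr
  calc Real.exp (-l / 2) / (27 * √l) = 1 / 3 * (Real.exp (-l / 2) / (9 * √l)) := by
        field_simp; norm_num
    _ ≤ _ := by gcongr

/-! ### The probability of a fit for a fixed right-hand side -/

lemma measurePreserving_reflectOn {ι : Type*} [Fintype ι] [DecidableEq ι] {n : ℕ}
    (e : EuclideanSpace ℝ (Fin n)) (τ : Finset ι) :
    MeasurePreserving (reflectOn e τ)
      (Measure.pi fun _ : ι => stdGaussian (EuclideanSpace ℝ (Fin n)))
      (Measure.pi fun _ : ι => stdGaussian (EuclideanSpace ℝ (Fin n))) := by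
  refine measurePreserving_pi _ _
    (f := fun i x => if i ∈ τ then negReflection e x else x) fun i => ?_
  split_ifs
  · exact ⟨(negReflection e).continuous.measurable, stdGaussian_map (negReflection e)⟩
  · exact .id _

lemma measurable_designOfColumns {n p : ℕ} :
    Measurable fun h : Fin p → EuclideanSpace ℝ (Fin n) => Matrix.of.symm (designOfColumns h) := by
  refine measurable_pi_lambda _ fun k => measurable_pi_lambda _ fun i => ?_
  have : (fun h : Fin p → EuclideanSpace ℝ (Fin n) => Matrix.of.symm (designOfColumns h) k i)
      = fun h => h i k / ‖h i‖ := rfl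
  rw [this]
  fun_prop

lemma measurableSet_hasFit_designOfColumns {n p : ℕ} (s : ℕ) (M : ℝ) :
    MeasurableSet {x : (Fin p → EuclideanSpace ℝ (Fin n)) × (Fin n → ℝ) |
      HasFit s (designOfColumns x.1) x.2 (M * l2Norm x.2)} :=
  ((measurable_designOfColumns.comp measurable_fst).prodMk measurable_snd)
    (measurableSet_hasFit (p := p) s M)

lemma measurableSet_hasFit_left {n p : ℕ} (s : ℕ) (M : ℝ) (e : EuclideanSpace ℝ (Fin n)) :
    MeasurableSet {h : Fin p → EuclideanSpace ℝ (Fin n) |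
      HasFit s (designOfColumns h) e.ofLp (M * ‖e‖)} :=
  measurable_prodMk_right (y := e.ofLp) (measurableSet_hasFit_designOfColumns (p := p) s M)

open Classical in
lemma alignedColumns_eq_filter {n p : ℕ} (s : ℕ) (M : ℝ) (e : EuclideanSpace ℝ (Fin n))
    (h : Fin p → EuclideanSpace ℝ (Fin n)) :
    alignedColumns s M e h =
      (Finset.univ.filter fun i : Fin p => s ≤ (i : ℕ)).filter
        fun i => h i ∈ {x | IsAligned M e x} := by
  ext i
  simp [mem_alignedColumns]

lemma measurable_card_alignedColumns {n p : ℕ} (s : ℕ) (M : ℝ) (e : EuclideanSpace ℝ (Fin n)) :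
    Measurable fun h : Fin p → EuclideanSpace ℝ (Fin n) =>
      ((alignedColumns s M e h).card : ℝ) := by
  classical
  have : (fun h : Fin p → EuclideanSpace ℝ (Fin n) => ((alignedColumns s M e h).card : ℝ))
      = fun h => ∑ i ∈ Finset.univ.filter fun i : Fin p => s ≤ (i : ℕ),
        {x | IsAligned M e x}.indicator (fun _ => (1 : ℝ)) (h i) := by
    ext h
    rw [alignedColumns_eq_filter]
    simp [Set.indicator_apply]
  rw [this]
  exact Finset.measurable_sum _ fun i _ =>
    (measurable_const.indicator (measurableSet_isAligned M e)).comp (measurable_pi_apply i)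

/-- With many aligned columns, a fit of small norm fails to exist with small probability: the
reflections of the columns along `e` preserve both the Gaussian measure and the set of aligned
columns, and few of them admit no such fit. -/
lemma measureReal_aligned_and_not_hasFit_le {n p : ℕ} (s : ℕ) {M : ℝ} (hM : 0 < M)
    {e : EuclideanSpace ℝ (Fin n)} (he : e ≠ 0) :
    (Measure.pi fun _ : Fin p => stdGaussian (EuclideanSpace ℝ (Fin n))).real
      {h | 4 * (n : ℝ) ≤ (alignedColumns s M e h).card ∧
        ¬ HasFit s (designOfColumns h) e.ofLp (M * ‖e‖)} ≤ Real.exp (-(n : ℝ) / 4) := by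
  classical
  set S : Set (Fin p → EuclideanSpace ℝ (Fin n)) :=
    {h | 4 * (n : ℝ) ≤ (alignedColumns s M e h).card ∧
        ¬ HasFit s (designOfColumns h) e.ofLp (M * ‖e‖)}
  have hS : MeasurableSet S :=
    (measurableSet_le measurable_const (measurable_card_alignedColumns s M e)).inter
      (measurableSet_hasFit_left s M e).compl
  have hmem : ∀ h, h ∈ S ↔ 4 * (n : ℝ) ≤ (alignedColumns s M e h).card ∧
      ¬ HasFit s (designOfColumns h) e.ofLp (M * ‖e‖) := fun _ => Iff.rfl
  -- The decidability instances of `Finset.filter` should not see through the definition of `S`.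
  clear_value S
  have hexp : 3 ^ n * (2 / 3 : ℝ) ^ (4 * n) ≤ Real.exp (-(n : ℝ) / 4) := by
    have h1 : (3 : ℝ) * (2 / 3) ^ 4 ≤ Real.exp (-1 / 4) := by
      have := Real.add_one_le_exp (-1 / 4 : ℝ)
      norm_num at this ⊢
      linarith
    calc 3 ^ n * (2 / 3 : ℝ) ^ (4 * n) = (3 * (2 / 3) ^ 4) ^ n := by rw [mul_pow, ← pow_mul]
      _ ≤ Real.exp (-1 / 4) ^ n := by gcongr
      _ = _ := by rw [← Real.exp_nat_mul]; congr 1; ring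
  have key := card_mul_measureReal_le_of_card_filter_le
    (Measure.pi fun _ : Fin p => stdGaussian (EuclideanSpace ℝ (Fin n)))
    (fun τ : Finset (Fin p) => reflectOn e τ) (measurePreserving_reflectOn e) hS
    (K := 2 ^ p * Real.exp (-(n : ℝ) / 4)) ?_
  · rw [Fintype.card_finset, Fintype.card_fin, Nat.cast_pow, Nat.cast_ofNat] at key
    exact le_of_mul_le_mul_left key (by positivity)
  · intro h
    by_cases hG : 4 * (n : ℝ) ≤ (alignedColumns s M e h).card
    · calc _ ≤ (((Finset.univ : Finset (Finset (Fin p))).filter fun τ =>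
            ¬ HasFit s (designOfColumns (reflectOn e τ h)) e.ofLp (M * ‖e‖)).card : ℝ) := by
            gcongr with τ
            exact fun hτ => ((hmem _).1 hτ).2
        _ ≤ 2 ^ p * (3 ^ n * (2 / 3) ^ (alignedColumns s M e h).card) :=
            card_not_hasFit_reflectOn_le he hM h
        _ ≤ 2 ^ p * (3 ^ n * (2 / 3) ^ (4 * n)) := by
            have : 4 * n ≤ (alignedColumns s M e h).card := by exact_mod_cast hG
            gcongr 2 ^ p * (3 ^ n * ?_)
            exact pow_le_pow_of_le_one (by norm_num) (by norm_num) this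
        _ ≤ _ := by gcongr
    · -- The reflections preserve the number of aligned columns, so none of them leads into `S`.
      refine le_of_eq_of_le (Nat.cast_eq_zero.2 (Finset.card_eq_zero.2
        (Finset.eq_empty_of_forall_notMem fun τ hτ => hG ?_))) (by positivity)
      rw [← alignedColumns_reflectOn τ]
      exact ((hmem _).1 (Finset.mem_filter.1 hτ).2).1

/-- The exponent of the Chernoff bound for at most `4 n` aligned columns among `p - n`. The
expected number of aligned columns is of order `√p / √(log p)`, which is at least
of order `n ^ (3 / 2)`. -/
lemma chernoff_exponent_le {n p : ℕ} (hn : 100 ≤ n) (hp : (16 * n) ^ 4 ≤ p) :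
    25 ≤ Real.log p ∧
    4 * (n : ℝ) - 3 / 5 * (Real.exp (-Real.log p / 2) / (27 * √(Real.log p))) * (p - n)
      ≤ -(n : ℝ) / 4 := by
  have hn' : (100 : ℝ) ≤ n := by exact_mod_cast hn
  have hp' : (16 * (n : ℝ)) ^ 4 ≤ p := by exact_mod_cast hp
  have hp0 : (0 : ℝ) < p := lt_of_lt_of_le (by positivity) hp'
  -- All quantities are expressed through the eighth root `z` of `p`.
  set z : ℝ := √√√(p : ℝ) with hz
  have hz0 : 0 < z := by positivity
  have hz8 : z ^ 8 = p := by
    rw [show z ^ 8 = ((z ^ 2) ^ 2) ^ 2 by ring, hz, Real.sq_sqrt (by positivity),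
      Real.sq_sqrt (by positivity), Real.sq_sqrt hp0.le]
  have hz2 : 16 * (n : ℝ) ≤ z ^ 2 := by
    refine le_of_pow_le_pow_left₀ (n := 4) (by norm_num) (by positivity) ?_
    rwa [← pow_mul, hz8]
  have hz40 : 40 ≤ z := by nlinarith
  have hlog : Real.log p = 8 * Real.log z := by
    rw [← hz8, Real.log_pow]; norm_num
  have hlogz : 27 / 8 ≤ Real.log z := by
    rw [Real.le_log_iff_exp_le hz0]
    have h1 := Real.exp_one_lt_d9
    calc Real.exp (27 / 8) = (Real.exp 1) ^ 3 * Real.exp (3 / 8) := by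
          rw [← Real.exp_nat_mul, ← Real.exp_add]; norm_num
      _ ≤ 2.719 ^ 3 * (1 + 3 / 8 + (3 / 8) ^ 2) := by
          have h7 := Real.abs_exp_sub_one_sub_id_le (x := 3 / 8)
            (by rw [abs_of_pos] <;> norm_num)
          have h8 := (abs_le.1 h7).2
          gcongr
          · linarith
          · linarith
      _ ≤ 40 := by norm_num
      _ ≤ z := hz40
  refine ⟨by rw [hlog]; linarith, ?_⟩
  have hsqrt : √(Real.log p) ≤ 2 * z := by
    refine Real.sqrt_le_iff.2 ⟨by positivity, ?_⟩
    have h1 : Real.log (z ^ 2) ≤ z ^ 2 - 1 := Real.log_le_sub_one_of_pos (by positivity)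
    rw [Real.log_pow] at h1
    push_cast at h1
    rw [hlog]
    nlinarith
  have hsqrt0 : 0 < √(Real.log p) := Real.sqrt_pos.2 (by rw [hlog]; linarith)
  have hexp : Real.exp (-Real.log p / 2) = (z ^ 4)⁻¹ := by
    rw [hlog, show -(8 * Real.log z) / 2 = -((4 : ℕ) * Real.log z) by push_cast; ring,
      Real.exp_neg, Real.exp_nat_mul, Real.exp_log hz0]
  have hq : (54 * z ^ 5)⁻¹ ≤ Real.exp (-Real.log p / 2) / (27 * √(Real.log p)) := by
    rw [hexp, div_eq_mul_inv, ← mul_inv]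
    refine inv_anti₀ (by positivity) ?_
    calc z ^ 4 * (27 * √(Real.log p)) ≤ z ^ 4 * (27 * (2 * z)) := by gcongr
      _ = _ := by ring
  have hpn : 99 / 100 * z ^ 8 ≤ p - n := by
    rw [← hz8]
    have h1 : z ^ 2 * 1 ≤ z ^ 2 * z ^ 6 := by
      gcongr
      exact one_le_pow₀ (by linarith)
    have h2 : z ^ 2 * z ^ 6 = z ^ 8 := by ring
    have h3 : (40 : ℝ) ^ 6 ≤ z ^ 6 := by gcongr
    nlinarith
  have hmain : 17 / 4 * (n : ℝ) ≤ 3 / 5 * (54 * z ^ 5)⁻¹ * (99 / 100 * z ^ 8) := by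
    have h1 : 3 / 5 * (54 * z ^ 5)⁻¹ * (99 / 100 * z ^ 8) = 11 / 1000 * (z * z ^ 2) := by
      field_simp
      norm_num
    rw [h1]
    nlinarith
  have : 3 / 5 * (54 * z ^ 5)⁻¹ * (99 / 100 * z ^ 8) ≤
      3 / 5 * (Real.exp (-Real.log p / 2) / (27 * √(Real.log p))) * (p - n) := by gcongr
  linarith

/-- For a fixed nonzero right-hand side, either few columns are aligned, or many are and yet no
fit of small norm exists; both events have probability at most `exp (-n / 4)`. -/
lemma measureReal_not_hasFit_le {n p s : ℕ} (hn : 100 ≤ n) (hp : (16 * n) ^ 4 ≤ p) (hs : s ≤ n)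
    {e : EuclideanSpace ℝ (Fin n)} (he : e ≠ 0) :
    (Measure.pi fun _ : Fin p => stdGaussian (EuclideanSpace ℝ (Fin n))).real
      {h | ¬ HasFit s (designOfColumns h) e.ofLp
        (√(1 + (3 * (n : ℝ) / 2) / Real.log p) * ‖e‖)} ≤ 2 * Real.exp (-(n : ℝ) / 4) := by
  classical
  obtain ⟨hlog, hbound⟩ := chernoff_exponent_le hn hp
  set M : ℝ := √(1 + (3 * (n : ℝ) / 2) / Real.log p)
  have hM : 0 < M := Real.sqrt_pos.2 (by positivity)
  set P := Measure.pi fun _ : Fin p => stdGaussian (EuclideanSpace ℝ (Fin n))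
  set q : ℝ := Real.exp (-Real.log p / 2) / (27 * √(Real.log p))
  have hq0 : 0 ≤ q := by positivity
  have hcount := measureReal_card_filter_le (stdGaussian (EuclideanSpace ℝ (Fin n)))
    (measurableSet_isAligned M e) (le_stdGaussian_isAligned he hlog)
    (Finset.univ.filter fun i : Fin p => s ≤ (i : ℕ)) (4 * n)
  simp_rw [← alignedColumns_eq_filter] at hcount
  have hcard : (p : ℝ) - n ≤ ((Finset.univ.filter fun i : Fin p => s ≤ (i : ℕ)).card : ℝ) := by
    have h1 := Finset.card_filter_add_card_filter_not (s := (Finset.univ : Finset (Fin p)))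
      (fun i : Fin p => s ≤ (i : ℕ))
    have h2 : (Finset.univ.filter fun i : Fin p => ¬ s ≤ (i : ℕ)).card ≤ s := by
      simpa using Finset.card_le_card_of_injOn (t := Finset.range s) (fun i : Fin p => (i : ℕ))
        (fun i hi => by simpa using hi) Fin.val_injective.injOn
    rw [Finset.card_univ, Fintype.card_fin] at h1
    have h3 : p ≤ (Finset.univ.filter fun i : Fin p => s ≤ (i : ℕ)).card + n := by omega
    have : (p : ℝ) ≤ (Finset.univ.filter fun i : Fin p => s ≤ (i : ℕ)).card + n := by
      exact_mod_cast h3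
    linarith
  have hfew : P.real {h | ((alignedColumns s M e h).card : ℝ) ≤ 4 * n} ≤
      Real.exp (-(n : ℝ) / 4) := by
    refine hcount.trans (Real.exp_le_exp.2 (le_trans ?_ hbound))
    have : 3 / 5 * q * ((p : ℝ) - n) ≤
        3 / 5 * q * ((Finset.univ.filter fun i : Fin p => s ≤ (i : ℕ)).card : ℝ) := by gcongr
    linarith
  calc _ ≤ P.real ({h | ((alignedColumns s M e h).card : ℝ) ≤ 4 * n} ∪
        {h | 4 * (n : ℝ) ≤ (alignedColumns s M e h).card ∧
          ¬ HasFit s (designOfColumns h) e.ofLp (M * ‖e‖)}) := by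
        refine measureReal_mono fun h hh => ?_
        rcases le_total ((alignedColumns s M e h).card : ℝ) (4 * n) with h1 | h1
        · exact Or.inl h1
        · exact Or.inr ⟨h1, hh⟩
    _ ≤ _ := measureReal_union_le _ _
    _ ≤ Real.exp (-(n : ℝ) / 4) + Real.exp (-(n : ℝ) / 4) :=
        add_le_add hfew (measureReal_aligned_and_not_hasFit_le s hM he)
    _ = _ := by ring

/-! ### The law of the sample and the conclusion -/

/-- The columns of the feature matrix are independent standard Gaussian vectors, and they are
independent of the noise, whose entries are independent Gaussian variables. -/
lemma IsGaussianSample.hasLaw {Ω : Type*} [MeasurableSpace Ω] {μ : Measure Ω}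
    [IsProbabilityMeasure μ] {n p : ℕ} {σ : ℝ≥0} {H : Fin n → Fin p → Ω → ℝ} {ε : Fin n → Ω → ℝ}
    (h : IsGaussianSample μ σ H ε) :
    HasLaw (fun ω => ((fun i => WithLp.toLp 2 fun k => H k i ω :
        Fin p → EuclideanSpace ℝ (Fin n)), fun k => ε k ω))
      ((Measure.pi fun _ : Fin p => stdGaussian (EuclideanSpace ℝ (Fin n))).prod
        (Measure.pi fun _ : Fin n => gaussianReal 0 (σ ^ 2))) μ := by
  set J := (Fin p × Fin n) ⊕ Fin n
  set X : J → Ω → ℝ := Sum.elim (fun q => H q.2 q.1) ε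
  set m : J → Measure ℝ := Sum.elim (fun _ => gaussianReal 0 1) (fun _ => gaussianReal 0 (σ ^ 2))
  have hmprob : ∀ j, IsProbabilityMeasure (m j) := by
    rintro (j | j) <;> simp only [m, Sum.elim_inl, Sum.elim_inr] <;> infer_instance
  have hX : ∀ j, HasLaw (X j) (m j) μ := by
    rintro (j | j)
    · exact h.law_feature j.2 j.1
    · exact h.law_noise j
  have hind : iIndepFun X μ := by
    have := h.indep.precomp (g := Sum.map (Prod.swap : Fin p × Fin n → Fin n × Fin p) id)
      (Prod.swap_injective.sumMap Function.injective_id)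
    convert this using 2 with j
    rcases j with j | j <;> rfl
  have hlaw : μ.map (fun ω j => X j ω) = Measure.pi m := by
    rw [hind.map_fun_eq_pi_map fun j => (hX j).aemeasurable]
    congr 1
    ext1 j
    exact (hX j).map_eq
  have hcurry : MeasurePreserving (MeasurableEquiv.curry (Fin p) (Fin n) ℝ)
      (Measure.pi fun _ : Fin p × Fin n => gaussianReal 0 1)
      (Measure.pi fun _ : Fin p => Measure.pi fun _ : Fin n => gaussianReal 0 1) := by
    refine ⟨MeasurableEquiv.measurable _, ?_⟩
    have := Measure.infinitePi_map_curry (fun (_ : Fin p) (_ : Fin n) => gaussianReal 0 1)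
    simpa only [Measure.infinitePi_eq_pi] using this
  have hcol : MeasurePreserving
      (fun (x : Fin p → Fin n → ℝ) i => (WithLp.toLp 2 (x i) : EuclideanSpace ℝ (Fin n)))
      (Measure.pi fun _ : Fin p => Measure.pi fun _ : Fin n => gaussianReal 0 1)
      (Measure.pi fun _ : Fin p => stdGaussian (EuclideanSpace ℝ (Fin n))) :=
    measurePreserving_pi _ _ fun _ => ⟨by fun_prop, map_pi_eq_stdGaussian⟩
  have hsum : MeasurePreserving (MeasurableEquiv.sumPiEquivProdPi fun _ : J => ℝ)
      (Measure.pi m) ((Measure.pi fun _ : Fin p × Fin n => gaussianReal 0 1).prod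
        (Measure.pi fun _ : Fin n => gaussianReal 0 (σ ^ 2))) :=
    measurePreserving_sumPiEquivProdPi m
  have htot := ((hcol.comp hcurry).prod
    (MeasurePreserving.id (Measure.pi fun _ : Fin n => gaussianReal 0 (σ ^ 2)))).comp hsum
  have hXm : AEMeasurable (fun ω j => X j ω) μ :=
    aemeasurable_pi_lambda _ fun j => (hX j).aemeasurable
  refine ⟨htot.measurable.comp_aemeasurable hXm, ?_⟩
  have := AEMeasurable.map_map_of_aemeasurable (μ := μ) (f := fun ω j => X j ω)
    htot.measurable.aemeasurable hXm
  rw [hlaw, htot.map_eq] at this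
  exact this.symm

theorem proposition3 {Ω : Type*} [MeasurableSpace Ω] (μ : Measure Ω) [IsProbabilityMeasure μ]
    (n p s : ℕ) (hn : 100 ≤ n) (hp : (16 * n) ^ 4 ≤ p) (hs : s ≤ n)
    (σ : ℝ≥0) (hσ : 0 < σ)
    (H : Fin n → Fin p → Ω → ℝ) (ε : Fin n → Ω → ℝ) (hmodel : IsGaussianSample μ σ H ε) :
    1 - 2 * Real.exp (-(n : ℝ) / 4) ≤
      μ.real {ω | noiseTrain ε ω ≠ 0 ∧
        (∃ w, IsMinNoiseFit s (Xtrain H ω) (noiseTrain ε ω) w) ∧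
        ∀ wI, IsMinNoiseFit s (Xtrain H ω) (noiseTrain ε ω) wI →
          l1Norm wI / l2Norm (noiseTrain ε ω) ≤
            √(1 + (3 * (n : ℝ) / 2) / Real.log (p : ℝ))} := by
  set M : ℝ := √(1 + (3 * (n : ℝ) / 2) / Real.log (p : ℝ)) with hM
  have hn0 : (0 : ℝ) < n := by exact_mod_cast (by omega : 0 < n)
  set P := Measure.pi fun _ : Fin p => stdGaussian (EuclideanSpace ℝ (Fin n))
  set Q := Measure.pi fun _ : Fin n => gaussianReal 0 (σ ^ 2)
  set scale : (Fin n → ℝ) → Fin n → ℝ := fun v k => v k / √(n : ℝ) with hscale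
  have hscale_ne : ∀ v, v ≠ 0 → scale v ≠ 0 := by
    intro v hv h0
    refine hv (funext fun k => ?_)
    have : v k / √(n : ℝ) = 0 := congrFun h0 k
    simpa [hn0.ne'] using this
  set G : Set ((Fin p → EuclideanSpace ℝ (Fin n)) × (Fin n → ℝ)) :=
    {x | x.2 ≠ 0 ∧ HasFit s (designOfColumns x.1) (scale x.2) (M * l2Norm (scale x.2))} with hG
  have hfit : MeasurableSet {x : (Fin p → EuclideanSpace ℝ (Fin n)) × (Fin n → ℝ) |
      HasFit s (designOfColumns x.1) (scale x.2) (M * l2Norm (scale x.2))} := by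
    have h1 : Measurable fun x : (Fin p → EuclideanSpace ℝ (Fin n)) × (Fin n → ℝ) =>
        (x.1, scale x.2) := by fun_prop
    exact h1 (measurableSet_hasFit_designOfColumns s M)
  have hGm : MeasurableSet G :=
    (measurable_snd (measurableSet_singleton (0 : Fin n → ℝ)).compl).inter hfit
  have hQ0 : ∀ᵐ v ∂Q, v ≠ 0 := by
    have : NullSingletonClass (gaussianReal 0 (σ ^ 2)) :=
      nullSingletonClass_gaussianReal (pow_ne_zero 2 hσ.ne')
    have h0 : Q {f | f ⟨0, by omega⟩ = 0} = 0 := Measure.pi_hyperplane _ _ 0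
    refine measure_mono_null (fun v hv => ?_) h0
    simp only [Set.mem_compl_iff, Set.mem_ofPred_eq, not_not] at hv
    simp [hv]
  have hbad : (P.prod Q) Gᶜ ≤ ENNReal.ofReal (2 * Real.exp (-(n : ℝ) / 4)) := by
    rw [Measure.prod_apply_symm hGm.compl]
    calc _ ≤ ∫⁻ _, ENNReal.ofReal (2 * Real.exp (-(n : ℝ) / 4)) ∂Q := by
          refine lintegral_mono_ae ?_
          filter_upwards [hQ0] with v hv
          have h1 := measureReal_not_hasFit_le hn hp hs (e := WithLp.toLp 2 (scale v))
            (by simpa using hscale_ne v hv)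
          rw [measureReal_def] at h1
          refine (ENNReal.le_ofReal_iff_toReal_le (measure_ne_top _ _) (by positivity)).2 ?_
          refine le_trans (le_of_eq ?_) h1
          congr 2
          ext h
          simp [hG, hv, l2Norm, hM]
      _ = _ := by simp
  have hgood : 1 - 2 * Real.exp (-(n : ℝ) / 4) ≤ (P.prod Q).real G := by
    have h1 : (P.prod Q).real Gᶜ ≤ 2 * Real.exp (-(n : ℝ) / 4) :=
      ENNReal.toReal_le_of_le_ofReal (by positivity) hbad
    rw [probReal_compl_eq_one_sub hGm] at h1
    linarith
  refine hgood.trans ?_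
  have hlaw := hmodel.hasLaw
  rw [← hlaw.map_eq, measureReal_def, Measure.map_apply_of_aemeasurable hlaw.aemeasurable hGm,
    ← measureReal_def]
  refine measureReal_mono fun ω hω => ?_
  obtain ⟨hε, w, hw, hwR⟩ := hω
  have he : noiseTrain ε ω ≠ 0 := hscale_ne _ hε
  have hepos : 0 < l2Norm (noiseTrain ε ω) := norm_pos_iff.2 (by simpa using he)
  refine ⟨he, exists_isMinNoiseFit ⟨w, hw⟩, fun wI hwI => ?_⟩
  rw [div_le_iff₀ hepos]
  exact (hwI.2 hw).trans hwR
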